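/- **Theorem 3.4.** Let $\varepsilon$ be a real random variable with law $\mu$, with $\mathbb{E}\varepsilon=0$, $\operatorname{var}(\varepsilon)=1$ and $\mathbb{E}\varepsilon^4<\infty$, and suppose that $\varepsilon^2$ and $\varepsilon$ are not perfectly correlated, in the sense that $\operatorname{cov}(\varepsilon^2,\varepsilon)^2<\operatorname{var}(\varepsilon^2)$ (equivalently, $\mu$ is not concentrated on two points). Let $\sigma>0$. For every $n\ge 1$ let $\Theta_n\subset\ell_2$ be a parameter set (for example $\Theta_n=\Theta$ not depending on $n$, or, in the finite sequence model, a subset of $\{\theta\in\ell_2:\theta_i=0 \text{ for } i>n\}$). For $\theta\in\Theta_n$, under the probability law $\mathbb{P}_\theta=\mathbb{P}_{n,\theta}$, let the observation be $X=(X_1,X_2,\dots)$ with $$X_i=\theta_i+\frac{\sigma}{\sqrt n}\,\varepsilon_i ,\qquad \varepsilon_1,\varepsilon_2,\dots \text{ i.i.d. with law } \mu,$$ and let the initial estimator $\hat\theta^{(n)}=(\hat\theta^{(n)}_1,\hat\theta^{(n)}_2,\dots)$ be a random sequence independent of $X$. Define $$R_{k,n}(\hat\theta^{(n)})=\sum_{i=1}^k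 (X_i-\hat\theta^{(n)}_i)^2-\frac{k\sigma^2}{n},$$ $$\hat\tau_{k,n,\theta}^2=\frac{k\sigma^4\operatorname{var}(\varepsilon^2)}{n^2}+\frac{4\sigma^2}{n}\sum_{i=1}^k(\theta_i-\hat\theta^{(n)}_i)^2+\frac{4\sigma^3}{n\sqrt n}\sum_{i=1}^k(\theta_i-\hat\theta^{(n)}_i)\operatorname{cov}(\varepsilon^2,\varepsilon),$$ with $\hat\tau_{k,n,\theta}\ge 0$ the square root of the latter. Let $k_n\to\infty$ be a sequence of natural numbers such that, for some real sequence $\eta_n\to0$, $$\sup_{\theta\in\Theta_n}\mathbb{P}_\theta\Bigl(\max_{1\le i\le k_n}|\hat\theta^{(n)}_i-\theta_i|^2>\eta_n\sum_{i=1}^{k_n}(\hat\theta^{(n)}_i-\theta_i)^2\Bigr)\to0\qquad(n\to\infty).$$ Then, as $n\to\infty$, $$\sup_{\theta\in\Theta_n}\ \sup_{x\in\mathbb{R}}\left|\mathbb{P}_\theta\left(\frac{R_{k_n,n}(\hat\theta^{(n)})-\sum_{i=1}^{k_n}(\theta_i-\hat\theta^{(n)}_i)^2}{\hat\tau_{k_n,n,\theta}}\le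 x\right)-\Phi(x)\right|\to0,$$ where $\Phi$ is the standard normal distribution function. -/

import Mathlib

open MeasureTheory ProbabilityTheory Filter Topology

/-- The observation `X` and the initial estimator `est` of the sequence model with sample size `n`,
noise level `σ`, mean sequence `θ` and error law `μ`, under the probability law `P`: the coordinates
of `X` are `X i = θ i + (σ / √n) ε i` for i.i.d. errors `ε i` of law `μ`, and the initial estimator
is a random sequence that is independent of the whole sequence `X`. (Coordinates are numbered from
`0`.) -/
structure IsSequenceModel {Ω : Type*} [MeasurableSpace Ω] (P : Measure Ω) (μ : Measure ℝ)
    (σ : ℝ) (n : ℕ) (θ : ℕ → ℝ) (X est : Ω → ℕ → ℝ) : Prop where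
  isProbabilityMeasure : IsProbabilityMeasure P
  exists_errors : ∃ ε : ℕ → Ω → ℝ, (∀ i, Measurable (ε i)) ∧ iIndepFun ε P ∧
    (∀ i, P.map (ε i) = μ) ∧ ∀ ω i, X ω i = θ i + σ / √(n : ℝ) * ε i ω
  measurable_est : Measurable est
  indep : IndepFun est X P

/-- The squared distance of the first `k` coordinates, `∑ (s i - t i) ^ 2`. -/
noncomputable def sqDist (k : ℕ) (s t : ℕ → ℝ) : ℝ :=
  ∑ i ∈ Finset.range k, (s i - t i) ^ 2

/-- The estimator `R` of the squared distance of the first `k` coordinates, as a function of the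
observation `x` and of the value `t` of the initial estimator. -/
noncomputable def sqDistEstimator (σ : ℝ) (n k : ℕ) (x t : ℕ → ℝ) : ℝ :=
  (∑ i ∈ Finset.range k, (x i - t i) ^ 2) - k * σ ^ 2 / n

/-- The squared scale `τ ^ 2` for errors of law `μ`, at the parameter `θ` and the value `t` of the
initial estimator. -/
noncomputable def scaleSq (μ : Measure ℝ) (σ : ℝ) (n k : ℕ) (θ t : ℕ → ℝ) : ℝ :=
  k * σ ^ 4 * Var[fun e : ℝ => e ^ 2; μ] / (n : ℝ) ^ 2
    + 4 * σ ^ 2 / n * ∑ i ∈ Finset.range k, (θ i - t i) ^ 2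
    + 4 * σ ^ 3 / (n * √(n : ℝ)) *
      ∑ i ∈ Finset.range k, (θ i - t i) * cov[fun e : ℝ => e ^ 2, fun e : ℝ => e; μ]

/-- The standardized statistic `(R - ∑ (θ i - t i) ^ 2) / τ`. -/
noncomputable def standardizedStat (μ : Measure ℝ) (σ : ℝ) (n k : ℕ) (θ x t : ℕ → ℝ) : ℝ :=
  (sqDistEstimator σ n k x t - sqDist k θ t) / √(scaleSq μ σ n k θ t)

/-! Write a = σ/√n. Given the value t of the initial estimator, (X_i - t_i)² - (θ_i - t_i)² - a² =
a²(ε_i² - 1) + 2a(θ_i - t_i)ε_i, so the numerator is a sum of independent centered variables with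
total variance τ². Since cov² < var, the covariance matrix of (ε², ε) is positive definite, and τ²
is at least a constant times k a⁴ + a² ∑ (θ_i - t_i)². Hence the normalized coefficients are
uniformly small once k is large and no coordinate of θ - t dominates: a Lindeberg condition that is
uniform in θ and t.

The core is `exists_forall_abs_real_quadLinSum_sub_cdf_le`, a central limit theorem uniform over all
small coefficients. It follows by contradiction from Lévy's continuity theorem, Pólya's theorem and
the estimate `norm_charFun_map_quadLinSum_sub_le`. Independence makes the law of the statistic a
mixture over t (`IsSequenceModel.real_standardizedStat_le_eq_integral`); the values t with a
dominating coordinate cost only their probability, which vanishes uniformly in θ. -/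

/-! ### Uniform convergence of distribution functions -/

/-- **Pólya's theorem**: pointwise convergence of monotone functions with values in `[0, 1]` to a
continuous distribution function is uniform. -/
theorem tendstoUniformly_of_monotone_of_tendsto {F : ℕ → ℝ → ℝ} {G : ℝ → ℝ}
    (hF : ∀ n, Monotone (F n)) (hF0 : ∀ n x, 0 ≤ F n x) (hF1 : ∀ n x, F n x ≤ 1)
    (hG : Monotone G) (hGc : Continuous G) (hbot : Tendsto G atBot (𝓝 0))
    (htop : Tendsto G atTop (𝓝 1)) (h : ∀ x, Tendsto (fun n => F n x) atTop (𝓝 (G x))) :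
    TendstoUniformly F G atTop := by
  have hG1 : ∀ x, G x ≤ 1 := fun x => hG.ge_of_tendsto htop x
  have hG0 : ∀ x, 0 ≤ G x := fun x => hG.le_of_tendsto hbot x
  have hsurj : ∀ p : ℝ, 0 < p → p < 1 → ∃ x, G x = p := fun p hp0 hp1 =>
    mem_range_of_exists_le_of_exists_ge hGc
      ((hbot.eventually (gt_mem_nhds hp0)).exists.imp fun _ => le_of_lt)
      ((htop.eventually (lt_mem_nhds hp1)).exists.imp fun _ => le_of_lt)
  rw [Metric.tendstoUniformly_iff]
  intro ε hε
  obtain ⟨N, hN⟩ := exists_nat_gt (3 / ε)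
  have hN0 : (0 : ℝ) < N := lt_trans (by positivity) hN
  have hNε : 2 / (N : ℝ) < ε := by
    rw [div_lt_iff₀ hε] at hN
    rw [div_lt_iff₀ hN0]
    linarith
  -- Grid of the j/N-quantiles of G. Grid spacing and convergence at the grid points each cost 1/N.
  have hq : ∀ j : ℕ, ∃ x, 0 < j → j < N → G x = j / N := fun j => by
    by_cases hj : 0 < j ∧ j < N
    · obtain ⟨x, hx⟩ := hsurj (j / N) (div_pos (by exact_mod_cast hj.1) hN0)
        ((div_lt_one hN0).2 (by exact_mod_cast hj.2))
      exact ⟨x, fun _ _ => hx⟩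
    · exact ⟨0, fun h1 h2 => absurd ⟨h1, h2⟩ hj⟩
  choose q hq using hq
  have hev : ∀ᶠ n in atTop, ∀ j ∈ Finset.range N, |F n (q j) - G (q j)| < 1 / N := by
    rw [eventually_all_finset]
    intro j _
    have := (Metric.tendsto_nhds.1 (h (q j))) (1 / N) (by positivity)
    simpa [Real.dist_eq] using this
  filter_upwards [hev] with n hn x
  rw [Real.dist_eq, abs_lt]
  have key : ∀ j : ℕ, 0 < j → j < N → |F n (q j) - j / N| < 1 / N := fun j h0 h1 => by
    have := hn j (Finset.mem_range.2 h1)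
    rwa [hq j h0 h1] at this
  have hNG : 0 ≤ N * G x := mul_nonneg hN0.le (hG0 x)
  have e2 : 2 / (N : ℝ) = 1 / N + 1 / N := by ring
  have e1 : (0 : ℝ) < 1 / N := by positivity
  constructor
  · have h1 := Nat.lt_floor_add_one (N * G x)
    have h2 := Nat.floor_le hNG
    -- The least j with G x < j/N; if j ≥ N there is no quantile, but then G x ≥ 1 - 1/N and F ≤ 1
    -- suffices.
    set j := ⌊N * G x⌋₊ + 1 with hj
    have hjc : ((j : ℕ) : ℝ) = ⌊N * G x⌋₊ + 1 := by simp [hj]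
    have h3 : G x < j / N := by rw [lt_div_iff₀ hN0, hjc]; linarith
    have h4 : (j : ℝ) / N ≤ G x + 1 / N := by
      rw [div_le_iff₀ hN0, hjc, add_mul, one_div_mul_cancel hN0.ne']; linarith
    rcases lt_or_ge j N with hjN | hjN
    · have h5 : x ≤ q j := by
        by_contra! hlt
        have := hG hlt.le
        rw [hq j (by omega) hjN] at this
        linarith
      have h6 := (abs_lt.1 (key j (by omega) hjN)).2
      have h7 := hF n h5
      linarith
    · have : (1 : ℝ) ≤ j / N := by
        rw [le_div_iff₀ hN0, one_mul]; exact_mod_cast hjN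
      have := hF1 n x
      linarith
  · have h1 := Nat.le_ceil (N * G x)
    have h2 := Nat.ceil_lt_add_one hNG
    -- Symmetrically, j = ⌈N G x⌉ - 1 lies just below; if it is not positive, G x ≤ 1/N and F ≥ 0
    -- suffices.
    rcases Nat.lt_or_ge 1 ⌈N * G x⌉₊ with hc | hc
    · obtain ⟨j, hj⟩ : ∃ j, ⌈N * G x⌉₊ = j + 1 := ⟨⌈N * G x⌉₊ - 1, by omega⟩
      rw [hj] at h1 h2 hc
      push_cast at h1 h2
      have h3 : (j : ℝ) / N < G x := by rw [div_lt_iff₀ hN0]; linarith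
      have h4 : G x ≤ j / N + 1 / N := by
        rw [← add_div, le_div_iff₀ hN0]; linarith
      have hjN : j < N := by
        have : (j : ℝ) < N := by nlinarith [hG1 x]
        exact_mod_cast this
      have h5 : q j ≤ x := by
        by_contra! hlt
        have := hG hlt.le
        rw [hq j (by omega) hjN] at this
        linarith
      have h6 := (abs_lt.1 (key j (by omega) hjN)).1
      have h7 := hF n h5
      linarith
    · have : (⌈N * G x⌉₊ : ℝ) ≤ 1 := by exact_mod_cast hc
      have h3 : G x ≤ 1 / N := by rw [le_div_iff₀ hN0]; linarith
      have := hF0 n x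
      linarith

/-- The jump of a distribution function at x is the mass of {x}. -/
theorem continuous_cdf_of_nullSingletonClass (ν : Measure ℝ) [IsProbabilityMeasure ν]
    [NullSingletonClass ν] : Continuous (cdf ν) := by
  rw [continuous_iff_continuousAt]
  intro x
  rw [(monotone_cdf ν).continuousAt_iff_leftLim_eq_rightLim, (cdf ν).rightLim_eq]
  refine le_antisymm ((monotone_cdf ν).leftLim_le le_rfl) ?_
  have h := (cdf ν).measure_singleton x
  rw [measure_cdf, measure_singleton] at h
  have := ENNReal.ofReal_eq_zero.1 h.symm
  linarith

/-- Weak convergence to a law without atoms entails uniform convergence of the distribution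
functions. -/
theorem tendstoUniformly_cdf_of_tendsto {ν : ℕ → ProbabilityMeasure ℝ} {ν₀ : ProbabilityMeasure ℝ}
    [NullSingletonClass (ν₀ : Measure ℝ)] (h : Tendsto ν atTop (𝓝 ν₀)) :
    TendstoUniformly (fun n x => cdf (ν n : Measure ℝ) x) (fun x => cdf (ν₀ : Measure ℝ) x)
      atTop := by
  refine tendstoUniformly_of_monotone_of_tendsto (fun n => monotone_cdf _)
    (fun n => cdf_nonneg _) (fun n => cdf_le_one _) (monotone_cdf _)
    (continuous_cdf_of_nullSingletonClass _) (tendsto_cdf_atBot _) (tendsto_cdf_atTop _) fun x => ?_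
  simp only [cdf_eq_real]
  have := ProbabilityMeasure.tendsto_measure_of_null_frontier_of_tendsto' h (E := Set.Iic x)
    (by rw [frontier_Iic]; exact measure_singleton x)
  exact (ENNReal.tendsto_toReal (measure_ne_top _ _)).comp this

/-! ### Estimates for characteristic functions -/

/-- Third-order Taylor remainder for |x| ≤ 1, triangle inequality beyond. The minimum keeps the
bound integrable with only two moments. -/
theorem norm_cexp_I_mul_sub_taylor_two_le (x : ℝ) :
    ‖Complex.exp (x * Complex.I) - (1 + x * Complex.I - x ^ 2 / 2)‖ ≤
      4 * (x ^ 2 * min 1 |x|) := by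
  rcases le_total |x| 1 with hx | hx
  · rw [min_eq_right hx]
    have hn : ‖(x : ℂ) * Complex.I‖ = |x| := by simp
    have := Complex.exp_bound (x := x * Complex.I) (by rw [hn]; exact hx) (n := 3) (by norm_num)
    rw [hn] at this
    simp only [Finset.sum_range_succ, Finset.range_zero, Finset.sum_empty] at this
    have e : (0 + (x * Complex.I) ^ 0 / (Nat.factorial 0 : ℂ) + (x * Complex.I) ^ 1 /
        (Nat.factorial 1 : ℂ) + (x * Complex.I) ^ 2 / (Nat.factorial 2 : ℂ)) =
        1 + x * Complex.I - (x : ℂ) ^ 2 / 2 := by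
      simp [mul_pow, Nat.factorial]; ring
    rw [e] at this
    refine this.trans ?_
    have h3 : |x| ^ 3 = x ^ 2 * |x| := by rw [pow_succ, sq_abs]
    rw [h3]
    have : 0 ≤ x ^ 2 * |x| := by positivity
    norm_num [Nat.factorial]
    linarith
  · rw [min_eq_left hx]
    have h1 : ‖Complex.exp (x * Complex.I)‖ = 1 := Complex.norm_exp_ofReal_mul_I x
    have h2 : ‖(1 + x * Complex.I - (x : ℂ) ^ 2 / 2)‖ ≤ 1 + |x| + x ^ 2 / 2 := by
      refine (norm_sub_le _ _).trans (add_le_add ((norm_add_le _ _).trans ?_) ?_)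
      · simp
      · simp
    have := norm_sub_le (Complex.exp (x * Complex.I)) (1 + x * Complex.I - (x : ℂ) ^ 2 / 2)
    have h4 : x ^ 2 = |x| ^ 2 := (sq_abs x).symm
    nlinarith

theorem abs_exp_neg_sub_one_sub_le {x : ℝ} (hx : 0 ≤ x) :
    |Real.exp (-x) - (1 - x)| ≤ x ^ 2 := by
  have h1 := Real.add_one_le_exp (-x)
  have h2 : Real.exp (-x) ≤ 1 / (1 + x) := by
    rw [Real.exp_neg, ← one_div]
    exact one_div_le_one_div_of_le (by positivity) (by linarith [Real.add_one_le_exp x])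
  have h3 : 1 / (1 + x) ≤ 1 - x + x ^ 2 := by
    rw [div_le_iff₀ (by positivity)]
    nlinarith [pow_nonneg hx 3]
  rw [abs_le]
  constructor <;> nlinarith

/-- Telescoping: exchange one factor at a time, the others having norm at most 1. -/
theorem norm_prod_sub_prod_le_sum {ι : Type*} (s : Finset ι) {a b : ι → ℂ}
    (ha : ∀ i ∈ s, ‖a i‖ ≤ 1) (hb : ∀ i ∈ s, ‖b i‖ ≤ 1) :
    ‖∏ i ∈ s, a i - ∏ i ∈ s, b i‖ ≤ ∑ i ∈ s, ‖a i - b i‖ := by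
  classical
  induction s using Finset.induction_on with
  | empty => simp
  | insert j s hj ih =>
    rw [Finset.prod_insert hj, Finset.prod_insert hj, Finset.sum_insert hj]
    have e : a j * ∏ i ∈ s, a i - b j * ∏ i ∈ s, b i =
        (a j - b j) * ∏ i ∈ s, a i + b j * (∏ i ∈ s, a i - ∏ i ∈ s, b i) := by ring
    rw [e]
    refine (norm_add_le _ _).trans (add_le_add ?_ ?_)
    · rw [norm_mul, norm_prod]
      exact mul_le_of_le_one_right (norm_nonneg _) (Finset.prod_le_one (fun _ _ => norm_nonneg _)
        fun i hi => ha i (Finset.mem_insert_of_mem hi))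
    · rw [norm_mul]
      refine (mul_le_of_le_one_left (norm_nonneg _) (hb j (Finset.mem_insert_self _ _))).trans ?_
      exact ih (fun i hi => ha i (Finset.mem_insert_of_mem hi))
        fun i hi => hb i (Finset.mem_insert_of_mem hi)

theorem MeasureTheory.MemLp.integrable_sq_mul_min {Ω : Type*} [MeasurableSpace Ω] {P : Measure Ω}
    {Z : Ω → ℝ} (hZ : MemLp Z 2 P) (δ : ℝ) :
    Integrable (fun ω => Z ω ^ 2 * min 1 |δ * Z ω|) P := by
  refine hZ.integrable_sq.mono' ?_ (ae_of_all _ fun ω => ?_)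
  · exact (hZ.aestronglyMeasurable.pow 2).mul
      (aestronglyMeasurable_const.inf (hZ.aestronglyMeasurable.const_mul δ).norm)
  · rw [Real.norm_eq_abs, abs_mul, abs_of_nonneg (sq_nonneg (Z ω)),
      abs_of_nonneg (le_min zero_le_one (abs_nonneg _))]
    exact mul_le_of_le_one_right (sq_nonneg _) (min_le_left _ _)

/-- Comparison of the characteristic function of a centered random variable with that of the
Gaussian law of the same variance, with a remainder of Lindeberg type. -/
theorem norm_integral_cexp_sub_exp_le {Ω : Type*} [MeasurableSpace Ω] {P : Measure Ω}
    [IsProbabilityMeasure P] {Y : Ω → ℝ} (hY : MemLp Y 2 P) (h0 : ∫ ω, Y ω ∂P = 0) (s : ℝ) :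
    ‖∫ ω, Complex.exp (s * Y ω * Complex.I) ∂P -
        (Real.exp (-(s ^ 2 * (∫ ω, Y ω ^ 2 ∂P) / 2)) : ℂ)‖ ≤
      4 * s ^ 2 * ∫ ω, Y ω ^ 2 * min 1 |s * Y ω| ∂P + s ^ 4 * (∫ ω, Y ω ^ 2 ∂P) ^ 2 := by
  set V := ∫ ω, Y ω ^ 2 ∂P with hV
  have hV0 : 0 ≤ V := integral_nonneg fun _ => sq_nonneg _
  have hi1 : Integrable Y P := hY.integrable one_le_two
  have hi2 : Integrable (fun ω => Y ω ^ 2) P := hY.integrable_sq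
  have hc1 : Integrable (fun ω => ((Y ω : ℝ) : ℂ)) P := hi1.ofReal
  have hc2 : Integrable (fun ω => ((Y ω ^ 2 : ℝ) : ℂ)) P := hi2.ofReal
  have hexp : Integrable (fun ω => Complex.exp (s * Y ω * Complex.I)) P := by
    refine (integrable_const (1 : ℝ)).mono' ?_ (ae_of_all _ fun ω => ?_)
    · have := hY.aestronglyMeasurable.aemeasurable
      exact AEMeasurable.aestronglyMeasurable (by fun_prop)
    · rw [← Complex.ofReal_mul, Complex.norm_exp_ofReal_mul_I]
  have hpoly : Integrable (fun ω => (1 : ℂ) + s * Complex.I * (Y ω : ℂ)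
      - (s : ℂ) ^ 2 / 2 * ((Y ω ^ 2 : ℝ) : ℂ)) P :=
    ((integrable_const _).add (hc1.const_mul _)).sub (hc2.const_mul _)
  have hpolyv : ∫ ω, ((1 : ℂ) + s * Complex.I * (Y ω : ℂ)
      - (s : ℂ) ^ 2 / 2 * ((Y ω ^ 2 : ℝ) : ℂ)) ∂P = ((1 - s ^ 2 * V / 2 : ℝ) : ℂ) := by
    have hlin : Integrable (fun ω => (1 : ℂ) + s * Complex.I * (Y ω : ℂ)) P :=
      (integrable_const _).add (hc1.const_mul _)
    rw [integral_sub hlin (hc2.const_mul _),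
      integral_add (integrable_const _) (hc1.const_mul _), integral_const_mul, integral_const_mul,
      integral_complex_ofReal, integral_complex_ofReal, h0, ← hV]
    simp
    ring
  have e1 : ‖∫ ω, Complex.exp (s * Y ω * Complex.I) ∂P - ((1 - s ^ 2 * V / 2 : ℝ) : ℂ)‖ ≤
      4 * s ^ 2 * ∫ ω, Y ω ^ 2 * min 1 |s * Y ω| ∂P := by
    rw [← hpolyv, ← integral_sub hexp hpoly, ← integral_const_mul]
    refine norm_integral_le_of_norm_le ((hY.integrable_sq_mul_min s).const_mul _)
      (ae_of_all _ fun ω => ?_)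
    have := norm_cexp_I_mul_sub_taylor_two_le (s * Y ω)
    push_cast at this ⊢
    convert this using 1
    · congr 1; ring
    · ring
  have e2 : ‖((1 - s ^ 2 * V / 2 : ℝ) : ℂ) - (Real.exp (-(s ^ 2 * V / 2)) : ℂ)‖ ≤
      s ^ 4 * V ^ 2 := by
    rw [← Complex.ofReal_sub, Complex.norm_real, Real.norm_eq_abs, abs_sub_comm]
    refine (abs_exp_neg_sub_one_sub_le (by positivity)).trans ?_
    have : 0 ≤ s ^ 4 * V ^ 2 := by positivity
    nlinarith
  exact (norm_sub_le_norm_sub_add_norm_sub _ _ _).trans (add_le_add e1 e2)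

/-! ### Moments of a single summand -/

section Moments

variable {μ : Measure ℝ} [IsProbabilityMeasure μ]

theorem memLp_sq_sub_one (h4 : MemLp (fun e : ℝ => e) 4 μ) :
    MemLp (fun e : ℝ => e ^ 2 - 1) 2 μ := by
  refine MemLp.sub ?_ (memLp_const 1)
  rw [memLp_two_iff_integrable_sq (by fun_prop)]
  have := h4.integrable_norm_pow (p := 4) (by norm_num)
  refine this.congr (ae_of_all _ fun e => ?_)
  simp only [Real.norm_eq_abs]
  rw [← pow_mul]
  exact (Even.pow_abs (by decide) e)

theorem memLp_two_of_four (h4 : MemLp (fun e : ℝ => e) 4 μ) : MemLp (fun e : ℝ => e) 2 μ :=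
  h4.mono_exponent (by norm_num)

/-- The standard combination of a centered squared error and an error. -/
def quadLin (α β e : ℝ) : ℝ := α * (e ^ 2 - 1) + β * e

theorem measurable_quadLin (α β : ℝ) : Measurable (quadLin α β) := by
  unfold quadLin; fun_prop

theorem memLp_quadLin (h4 : MemLp (fun e : ℝ => e) 4 μ) (α β : ℝ) :
    MemLp (quadLin α β) 2 μ :=
  ((memLp_sq_sub_one h4).const_mul α).add ((memLp_two_of_four h4).const_mul β)

theorem integral_sq_eq_one (h4 : MemLp (fun e : ℝ => e) 4 μ) (h0 : ∫ e, e ∂μ = 0)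
    (h1 : Var[fun e : ℝ => e; μ] = 1) : ∫ e, e ^ 2 ∂μ = 1 := by
  rw [variance_eq_sub (memLp_two_of_four h4)] at h1
  simpa [h0] using h1

theorem integral_quadLin (h4 : MemLp (fun e : ℝ => e) 4 μ) (h0 : ∫ e, e ∂μ = 0)
    (h1 : Var[fun e : ℝ => e; μ] = 1) (α β : ℝ) : ∫ e, quadLin α β e ∂μ = 0 := by
  unfold quadLin
  have i2 := (memLp_two_of_four h4).integrable_sq
  have i1 := (memLp_two_of_four h4).integrable one_le_two
  have i3 : Integrable (fun e : ℝ => α * (e ^ 2 - 1)) μ :=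
    (i2.sub (integrable_const 1)).const_mul α
  rw [integral_add i3 (i1.const_mul β),
    integral_const_mul, integral_const_mul, integral_sub i2 (integrable_const 1), h0,
    integral_sq_eq_one h4 h0 h1]
  simp

/-- The second moment of `quadLin α β` in terms of the moments of the error. -/
theorem integral_quadLin_sq (h4 : MemLp (fun e : ℝ => e) 4 μ) (h0 : ∫ e, e ∂μ = 0)
    (h1 : Var[fun e : ℝ => e; μ] = 1) (α β : ℝ) :
    ∫ e, quadLin α β e ^ 2 ∂μ = α ^ 2 * Var[fun e : ℝ => e ^ 2; μ] + β ^ 2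
      + 2 * α * β * cov[fun e : ℝ => e ^ 2, fun e : ℝ => e; μ] := by
  have m2 : MemLp (fun e : ℝ => e ^ 2) 2 μ := by
    refine ((memLp_sq_sub_one h4).add (memLp_const (1 : ℝ))).congr_norm (by fun_prop)
      (ae_of_all _ fun e => ?_)
    simp
  have m1 := memLp_two_of_four h4
  have hv : Var[quadLin α β; μ] = ∫ e, quadLin α β e ^ 2 ∂μ := by
    rw [variance_eq_integral (measurable_quadLin α β).aemeasurable, integral_quadLin h4 h0 h1]
    simp
  have e : quadLin α β = fun e => (α * e ^ 2 + β * e) - α := by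
    ext e; simp only [quadLin]; ring
  have ha : MemLp (fun e : ℝ => α * e ^ 2) 2 μ := m2.const_mul α
  have hb : MemLp (fun e : ℝ => β * e) 2 μ := m1.const_mul β
  have hab : AEStronglyMeasurable (fun e : ℝ => α * e ^ 2 + β * e) μ :=
    (ha.add hb).aestronglyMeasurable
  rw [← hv, e, variance_sub_const hab,
    variance_fun_add ha hb, variance_const_mul, variance_const_mul, covariance_const_mul_left,
    covariance_const_mul_right, h1]
  ring

/-- An envelope of `quadLin α β` for coefficients in `[-1, 1]`. -/
def quadLinEnvelope (e : ℝ) : ℝ := |e ^ 2 - 1| + |e|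

theorem quadLinEnvelope_nonneg (e : ℝ) : 0 ≤ quadLinEnvelope e := by
  unfold quadLinEnvelope; positivity

theorem memLp_quadLinEnvelope (h4 : MemLp (fun e : ℝ => e) 4 μ) :
    MemLp quadLinEnvelope 2 μ :=
  (memLp_sq_sub_one h4).norm.add (memLp_two_of_four h4).norm

theorem abs_quadLin_le {α β r : ℝ} (hα : |α| ≤ r) (hβ : |β| ≤ r) (e : ℝ) :
    |quadLin α β e| ≤ r * quadLinEnvelope e := by
  unfold quadLin quadLinEnvelope
  refine (abs_add_le _ _).trans ?_
  rw [abs_mul, abs_mul, mul_add]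
  gcongr

/-- Cauchy–Schwarz. The factor α² + β² is kept, instead of a uniform bound, because it is comparable
to the variance of the summand, and the variances add up to 1. -/
theorem quadLin_sq_le (α β e : ℝ) :
    quadLin α β e ^ 2 ≤ (α ^ 2 + β ^ 2) * quadLinEnvelope e ^ 2 := by
  have h : (e ^ 2 - 1) ^ 2 + e ^ 2 ≤ quadLinEnvelope e ^ 2 := by
    unfold quadLinEnvelope
    rw [add_sq, sq_abs, sq_abs]
    have : 0 ≤ 2 * |e ^ 2 - 1| * |e| := by positivity
    linarith
  refine le_trans ?_ (mul_le_mul_of_nonneg_left h (by positivity))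
  unfold quadLin
  nlinarith [sq_nonneg (α * e - β * (e ^ 2 - 1))]

/-- A positive definite form with matrix `[[v, c], [c, 1]]` is bounded below. -/
theorem mul_sq_add_sq_le_of_sq_lt {v c : ℝ} (h : c ^ 2 < v) (α β : ℝ) :
    (v - c ^ 2) / (1 + v) * (α ^ 2 + β ^ 2) ≤ α ^ 2 * v + β ^ 2 + 2 * α * β * c := by
  have hv : 0 < 1 + v := by nlinarith [sq_nonneg c]
  -- The constant is determinant over trace, a lower bound for the least eigenvalue; after clearing
  -- the denominator the difference is exactly the sum of the two squares below.
  rw [div_mul_eq_mul_div, div_le_iff₀ hv]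
  nlinarith [sq_nonneg (c * β + v * α), sq_nonneg (β + c * α)]

end Moments

/-! ### Central limit theorem uniform in the coefficients -/

section CentralLimit

variable {μ : Measure ℝ} [IsProbabilityMeasure μ]

/-- The sum `∑ α (e i ^ 2 - 1) + β i e i` over the first `k` coordinates. -/
def quadLinSum (k : ℕ) (α : ℝ) (β : ℕ → ℝ) (e : ℕ → ℝ) : ℝ :=
  ∑ i ∈ Finset.range k, quadLin α (β i) (e i)

theorem measurable_quadLinSum (k : ℕ) (α : ℝ) (β : ℕ → ℝ) :
    Measurable (quadLinSum k α β) :=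
  Finset.measurable_sum _ fun i _ => (measurable_quadLin α (β i)).comp (measurable_pi_apply i)

theorem charFun_map_quadLinSum (k : ℕ) (α : ℝ) (β : ℕ → ℝ) (s : ℝ) :
    charFun ((Measure.infinitePi fun _ : ℕ => μ).map (quadLinSum k α β)) s =
      ∏ i ∈ Finset.range k, ∫ e, Complex.exp (s * quadLin α (β i) e * Complex.I) ∂μ := by
  have hind : iIndepFun (fun i (e : ℕ → ℝ) => quadLin α (β i) (e i))
      (Measure.infinitePi fun _ : ℕ => μ) :=
    iIndepFun_infinitePi fun i => measurable_quadLin α (β i)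
  have := (hind.restrict (Finset.range k)).charFun_map_fun_finsetSum_eq_prod
    (s := Finset.range k)
    fun i _ => ((measurable_quadLin α (β i)).comp (measurable_pi_apply i)).aemeasurable
  have h2 : charFun ((Measure.infinitePi fun _ : ℕ => μ).map
      fun e : ℕ → ℝ => ∑ i ∈ Finset.range k, quadLin α (β i) (e i)) s =
      (∏ i ∈ Finset.range k, charFun ((Measure.infinitePi fun _ : ℕ => μ).map
        fun e : ℕ → ℝ => quadLin α (β i) (e i))) s := congrFun this s
  rw [show quadLinSum k α β = fun e => ∑ i ∈ Finset.range k, quadLin α (β i) (e i) from rfl, h2,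
    Finset.prod_apply]
  refine Finset.prod_congr rfl fun i _ => ?_
  have hm : (Measure.infinitePi fun _ : ℕ => μ).map (fun e : ℕ → ℝ => quadLin α (β i) (e i)) =
      μ.map (quadLin α (β i)) := by
    have h := Measure.map_map (μ := Measure.infinitePi fun _ : ℕ => μ)
      (measurable_quadLin α (β i)) (measurable_pi_apply i)
    rw [Measure.infinitePi_map_eval (fun _ : ℕ => μ) i] at h
    exact h.symm
  rw [hm, charFun_apply_real, integral_map (measurable_quadLin α (β i)).aemeasurable
    (by fun_prop)]

/-- A bound on the characteristic function of `quadLinSum` with unit variance that depends only on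
the bound `r` on the coefficients. -/
theorem norm_charFun_map_quadLinSum_sub_le (h4 : MemLp (fun e : ℝ => e) 4 μ)
    (h0 : ∫ e, e ∂μ = 0) (h1 : Var[fun e : ℝ => e; μ] = 1) {k : ℕ} {α r : ℝ} {β : ℕ → ℝ} {κ : ℝ}
    (hκ : 0 < κ) (hα : |α| ≤ r) (hβ : ∀ i < k, |β i| ≤ r)
    (hsum : ∑ i ∈ Finset.range k, ∫ e, quadLin α (β i) e ^ 2 ∂μ = 1)
    (hlow : ∀ i < k, κ * (α ^ 2 + β i ^ 2) ≤ ∫ e, quadLin α (β i) e ^ 2 ∂μ) (s : ℝ) :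
    ‖charFun ((Measure.infinitePi fun _ : ℕ => μ).map (quadLinSum k α β)) s -
        (Real.exp (-(s ^ 2 / 2)) : ℂ)‖ ≤
      4 * s ^ 2 / κ * ∫ e, quadLinEnvelope e ^ 2 * min 1 |s * r * quadLinEnvelope e| ∂μ
        + s ^ 4 * r ^ 2 * ∫ e, quadLinEnvelope e ^ 2 ∂μ := by
  have hr : 0 ≤ r := (abs_nonneg α).trans hα
  set V : ℕ → ℝ := fun i => ∫ e, quadLin α (β i) e ^ 2 ∂μ with hV
  set M := ∫ e, quadLinEnvelope e ^ 2 * min 1 |s * r * quadLinEnvelope e| ∂μ with hM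
  set Z := ∫ e, quadLinEnvelope e ^ 2 ∂μ with hZ
  have hV0 : ∀ i, 0 ≤ V i := fun i => integral_nonneg fun _ => sq_nonneg _
  have hM0 : 0 ≤ M := integral_nonneg fun e =>
    mul_nonneg (sq_nonneg _) (le_min zero_le_one (abs_nonneg _))
  have hVZ : ∀ i < k, V i ≤ r ^ 2 * Z := fun i hi => by
    rw [hZ, ← integral_const_mul]
    refine integral_mono (memLp_quadLin h4 α (β i)).integrable_sq
      ((memLp_quadLinEnvelope h4).integrable_sq.const_mul _) fun e => ?_
    simp only
    rw [← mul_pow, ← sq_abs (quadLin α (β i) e)]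
    exact pow_le_pow_left₀ (abs_nonneg _) (abs_quadLin_le hα (hβ i hi) e) 2
  -- Each Lindeberg term is at most its share `V i` of the variance times a common factor, so the
  -- sum over i does not depend on k.
  have hL : ∀ i < k, ∫ e, quadLin α (β i) e ^ 2 * min 1 |s * quadLin α (β i) e| ∂μ ≤
      V i / κ * M := fun i hi => by
    rw [hM, ← integral_const_mul]
    refine integral_mono ((memLp_quadLin h4 α (β i)).integrable_sq_mul_min s)
      (((memLp_quadLinEnvelope h4).integrable_sq_mul_min (s * r)).const_mul _) fun e => ?_
    simp only
    rw [← mul_assoc]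
    refine mul_le_mul ((quadLin_sq_le α (β i) e).trans ?_) (min_le_min le_rfl ?_)
      (le_min zero_le_one (abs_nonneg _))
      (mul_nonneg (div_nonneg (hV0 i) hκ.le) (sq_nonneg _))
    · refine mul_le_mul_of_nonneg_right ?_ (sq_nonneg _)
      rw [le_div_iff₀ hκ, mul_comm]
      exact hlow i hi
    · rw [mul_assoc, abs_mul, abs_mul s, abs_mul r, abs_of_nonneg hr,
        abs_of_nonneg (quadLinEnvelope_nonneg e)]
      exact mul_le_mul_of_nonneg_left (abs_quadLin_le hα (hβ i hi) e) (abs_nonneg _)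
  have hexp : (Real.exp (-(s ^ 2 / 2)) : ℂ) =
      ∏ i ∈ Finset.range k, (Real.exp (-(s ^ 2 * V i / 2)) : ℂ) := by
    rw [← Complex.ofReal_prod, ← Real.exp_sum]
    congr 2
    rw [Finset.sum_neg_distrib, ← Finset.sum_div, ← Finset.mul_sum, hsum, mul_one]
  rw [charFun_map_quadLinSum, hexp]
  refine (norm_prod_sub_prod_le_sum _ (fun i _ => ?_) fun i _ => ?_).trans ?_
  · refine (norm_integral_le_of_norm_le_const (C := 1) (ae_of_all _ fun e => ?_)).trans (by simp)
    rw [← Complex.ofReal_mul, Complex.norm_exp_ofReal_mul_I]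
  · rw [Complex.norm_real, Real.norm_eq_abs, Real.abs_exp, Real.exp_le_one_iff]
    have := hV0 i
    have : 0 ≤ s ^ 2 * V i / 2 := by positivity
    linarith
  · calc _ ≤ ∑ i ∈ Finset.range k, V i * (4 * s ^ 2 / κ * M + s ^ 4 * r ^ 2 * Z) := by
          refine Finset.sum_le_sum fun i hi => ?_
          have hi := Finset.mem_range.1 hi
          refine (norm_integral_cexp_sub_exp_le (memLp_quadLin h4 α (β i))
            (integral_quadLin h4 h0 h1 α (β i)) s).trans ?_
          rw [mul_add]
          refine add_le_add ?_ ?_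
          · refine (mul_le_mul_of_nonneg_left (hL i hi) (by positivity)).trans (le_of_eq ?_)
            ring
          · have := mul_le_mul_of_nonneg_left (hVZ i hi) (hV0 i)
            have := mul_le_mul_of_nonneg_left this (by positivity : 0 ≤ s ^ 4)
            refine le_trans (le_of_eq ?_) (this.trans (le_of_eq ?_)) <;> simp only [V] <;> ring
      _ = _ := by rw [← Finset.sum_mul, hsum, one_mul]

/-- Dominated convergence; the envelope is square integrable because the error has a fourth moment.
-/
theorem tendsto_integral_sq_mul_min (h4 : MemLp (fun e : ℝ => e) 4 μ) (s : ℝ) {r : ℕ → ℝ}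
    (hr : Tendsto r atTop (𝓝 0)) :
    Tendsto (fun m => ∫ e, quadLinEnvelope e ^ 2 * min 1 |s * r m * quadLinEnvelope e| ∂μ) atTop
      (𝓝 0) := by
  have hZ := memLp_quadLinEnvelope h4
  rw [← integral_zero ℝ ℝ (μ := μ)]
  refine tendsto_integral_of_dominated_convergence (fun e => quadLinEnvelope e ^ 2)
    (fun m => (hZ.integrable_sq_mul_min (s * r m)).aestronglyMeasurable) hZ.integrable_sq
    (fun m => ae_of_all _ fun e => ?_) (ae_of_all _ fun e => ?_)
  · rw [Real.norm_eq_abs, abs_mul, abs_of_nonneg (sq_nonneg (quadLinEnvelope e)),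
      abs_of_nonneg (le_min zero_le_one (abs_nonneg _))]
    exact mul_le_of_le_one_right (sq_nonneg _) (min_le_left _ _)
  · have h : Tendsto (fun m => s * r m * quadLinEnvelope e) atTop (𝓝 0) := by
      simpa using (hr.const_mul s).mul_const (quadLinEnvelope e)
    have h' : Tendsto (fun m => min 1 |s * r m * quadLinEnvelope e|) atTop (𝓝 0) := by
      simpa using (tendsto_const_nhds (x := (1 : ℝ))).min h.abs
    simpa using h'.const_mul (quadLinEnvelope e ^ 2)

/-- A central limit theorem for `quadLinSum` with unit variance, uniform in the coefficients as
long as these are small. -/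
theorem exists_forall_abs_real_quadLinSum_sub_cdf_le (h4 : MemLp (fun e : ℝ => e) 4 μ)
    (h0 : ∫ e, e ∂μ = 0) (h1 : Var[fun e : ℝ => e; μ] = 1) {κ : ℝ} (hκ : 0 < κ)
    (hlow : ∀ α β, κ * (α ^ 2 + β ^ 2) ≤ ∫ e, quadLin α β e ^ 2 ∂μ) {δ : ℝ} (hδ : 0 < δ) :
    ∃ r > 0, ∀ (k : ℕ) (α : ℝ) (β : ℕ → ℝ), |α| ≤ r → (∀ i < k, |β i| ≤ r) →
      ∑ i ∈ Finset.range k, ∫ e, quadLin α (β i) e ^ 2 ∂μ = 1 →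
      ∀ x, |(Measure.infinitePi fun _ : ℕ => μ).real {e | quadLinSum k α β e ≤ x}
        - cdf (gaussianReal 0 1) x| ≤ δ := by
  by_contra! hcon
  -- Counterexamples with coefficients at most 1/(m+1) form a sequence of laws tending to the
  -- Gaussian. The points `x m` vary with m, hence the need for uniform convergence.
  have hcon' : ∀ m : ℕ, _ := fun m => hcon (1 / ((m : ℝ) + 1)) (by positivity)
  choose k α β hα hβ hsum x hx using hcon'
  let ν : ℕ → ProbabilityMeasure ℝ := fun m =>
    ⟨(Measure.infinitePi fun _ : ℕ => μ).map (quadLinSum (k m) (α m) (β m)),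
      Measure.isProbabilityMeasure_map (measurable_quadLinSum _ _ _).aemeasurable⟩
  let ν₀ : ProbabilityMeasure ℝ := ⟨gaussianReal 0 1, inferInstance⟩
  have hr : Tendsto (fun m : ℕ => 1 / ((m : ℝ) + 1)) atTop (𝓝 0) :=
    tendsto_one_div_add_atTop_nhds_zero_nat
  have hν : Tendsto ν atTop (𝓝 ν₀) := by
    refine ProbabilityMeasure.tendsto_of_tendsto_charFun fun s => ?_
    have e : charFun (ν₀ : Measure ℝ) s = (Real.exp (-(s ^ 2 / 2)) : ℂ) := by
      change charFun (gaussianReal 0 1) s = _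
      rw [charFun_gaussianReal]
      push_cast
      congr 1
      simp
    rw [e, tendsto_iff_norm_sub_tendsto_zero]
    refine squeeze_zero (fun _ => norm_nonneg _) (fun m =>
      norm_charFun_map_quadLinSum_sub_le h4 h0 h1 hκ (hα m) (hβ m) (hsum m)
        (fun i _ => hlow _ _) s) ?_
    simpa using ((tendsto_integral_sq_mul_min h4 s hr).const_mul (4 * s ^ 2 / κ)).add
      (((hr.pow 2).const_mul (s ^ 4)).mul_const (∫ e, quadLinEnvelope e ^ 2 ∂μ))
  have : NullSingletonClass (ν₀ : Measure ℝ) :=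
    nullSingletonClass_gaussianReal (by norm_num)
  have hu := tendstoUniformly_cdf_of_tendsto hν
  rw [Metric.tendstoUniformly_iff] at hu
  obtain ⟨m, hm⟩ := (hu δ hδ).exists
  have h2 := hm (x m)
  rw [dist_comm, Real.dist_eq] at h2
  have h3 : cdf (ν m : Measure ℝ) (x m) = (Measure.infinitePi fun _ : ℕ => μ).real
      {e | quadLinSum (k m) (α m) (β m) e ≤ x m} := by
    rw [cdf_eq_real]
    exact map_measureReal_apply (measurable_quadLinSum _ _ _) measurableSet_Iic
  rw [h3] at h2
  exact absurd h2 (not_lt.2 (hx m).le)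

end CentralLimit

/-! ### Conditioning on the initial estimator -/

/-- If a function with values in `[0, 1]` is within `δ` of `c ∈ [0, 1]` off a set `B`, then so is
its mean, up to the measure of `B`. -/
theorem abs_integral_sub_le_real_add {T : Type*} [MeasurableSpace T] {ν : Measure T}
    [IsProbabilityMeasure ν] {f : T → ℝ} (hf : Measurable f) (hf0 : ∀ t, 0 ≤ f t)
    (hf1 : ∀ t, f t ≤ 1) {c δ : ℝ} (hc0 : 0 ≤ c) (hc1 : c ≤ 1) (hδ : 0 ≤ δ) {B : Set T}
    (hB : MeasurableSet B) (h : ∀ t ∉ B, |f t - c| ≤ δ) :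
    |∫ t, f t ∂ν - c| ≤ ν.real B + δ := by
  have hfi : Integrable f ν := (integrable_const (1 : ℝ)).mono' hf.aestronglyMeasurable
    (ae_of_all _ fun t => by rw [Real.norm_eq_abs, abs_of_nonneg (hf0 t)]; exact hf1 t)
  have hBi : Integrable (B.indicator fun _ => (1 : ℝ)) ν :=
    (integrable_const (1 : ℝ)).indicator hB
  have e : ∫ t, f t ∂ν - c = ∫ t, (f t - c) ∂ν := by
    rw [integral_sub hfi (integrable_const c)]; simp
  have e2 : ν.real B + δ = ∫ t, (B.indicator (fun _ => (1 : ℝ)) t + δ) ∂ν := by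
    rw [integral_add hBi (integrable_const δ), integral_indicator_const _ hB]; simp
  rw [e, e2, ← Real.norm_eq_abs]
  refine norm_integral_le_of_norm_le (hBi.add (integrable_const δ)) (ae_of_all _ fun t => ?_)
  rw [Real.norm_eq_abs]
  by_cases ht : t ∈ B
  · simp only [Set.indicator_of_mem ht]
    have := abs_sub_le_of_nonneg_of_le (hf0 t) (hf1 t) hc0 hc1
    linarith
  · simp only [Set.indicator_of_notMem ht, zero_add]
    exact h t ht

theorem measurable_sqDist_left (k : ℕ) (θ : ℕ → ℝ) : Measurable fun t => sqDist k t θ := by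
  unfold sqDist; fun_prop

theorem measurable_scaleSq (μ : Measure ℝ) (σ : ℝ) (n k : ℕ) (θ : ℕ → ℝ) :
    Measurable fun t => scaleSq μ σ n k θ t := by
  unfold scaleSq; fun_prop

theorem measurable_standardizedStat (μ : Measure ℝ) (σ : ℝ) (n k : ℕ) (θ : ℕ → ℝ) :
    Measurable fun p : (ℕ → ℝ) × (ℕ → ℝ) => standardizedStat μ σ n k θ p.2 p.1 := by
  have h := (measurable_scaleSq μ σ n k θ).comp
    (measurable_fst : Measurable fun p : (ℕ → ℝ) × (ℕ → ℝ) => p.1)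
  refine Measurable.div ?_ h.sqrt
  unfold sqDistEstimator sqDist
  fun_prop

/-- Conditioning on the initial estimator: the law of the statistic is the mixture of its laws
for fixed values of the estimator. -/
theorem IsSequenceModel.real_standardizedStat_le_eq_integral {Ω : Type*} [MeasurableSpace Ω]
    {P : Measure Ω} {μ : Measure ℝ} [IsProbabilityMeasure μ] {σ : ℝ} {n : ℕ} {θ : ℕ → ℝ}
    {X est : Ω → ℕ → ℝ} (h : IsSequenceModel P μ σ n θ X est) (hσ : 0 < σ) (hn : 1 ≤ n)
    (k : ℕ) (x : ℝ) :
    P.real {ω | standardizedStat μ σ n k θ (X ω) (est ω) ≤ x} =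
      ∫ t, (Measure.infinitePi fun _ : ℕ => μ).real
        {e | standardizedStat μ σ n k θ (fun i => θ i + σ / √(n : ℝ) * e i) t ≤ x}
        ∂(P.map est) := by
  have := h.isProbabilityMeasure
  obtain ⟨ε, hεm, hεi, hεl, hX⟩ := h.exists_errors
  have ha : σ / √(n : ℝ) ≠ 0 := by positivity
  have hεm' : Measurable fun ω i => ε i ω := measurable_pi_iff.2 hεm
  have hlaw : P.map (fun ω i => ε i ω) = Measure.infinitePi fun _ : ℕ => μ := by
    rw [hεi.map_fun_eq_infinitePi_map hεm]; simp_rw [hεl]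
  have hind : IndepFun est (fun ω i => ε i ω) P := by
    -- The errors are a measurable function of the observation, so they inherit its independence
    -- from the estimator.
    have e : (fun ω i => ε i ω) =
        (fun x : ℕ → ℝ => fun i => (x i - θ i) / (σ / √(n : ℝ))) ∘ X := by
      ext ω i
      change ε i ω = (X ω i - θ i) / (σ / √(n : ℝ))
      rw [hX, eq_div_iff ha]
      ring
    rw [e]
    exact h.indep.comp measurable_id (by fun_prop)
  have hjoint := (indepFun_iff_map_prod_eq_prod_map_map h.measurable_est.aemeasurable
    hεm'.aemeasurable).1 hind
  rw [hlaw] at hjoint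
  have hPm : IsProbabilityMeasure (P.map est) :=
    Measure.isProbabilityMeasure_map h.measurable_est.aemeasurable
  set A : Set ((ℕ → ℝ) × (ℕ → ℝ)) :=
    {p | standardizedStat μ σ n k θ (fun i => θ i + σ / √(n : ℝ) * p.2 i) p.1 ≤ x} with hA
  have hAm : MeasurableSet A := by
    have hm : Measurable fun p : (ℕ → ℝ) × (ℕ → ℝ) =>
        (p.1, fun i => θ i + σ / √(n : ℝ) * p.2 i) := by fun_prop
    exact ((measurable_standardizedStat μ σ n k θ).comp hm) measurableSet_Iic
  have e1 : {ω | standardizedStat μ σ n k θ (X ω) (est ω) ≤ x} =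
      (fun ω => (est ω, fun i => ε i ω)) ⁻¹' A := by
    ext ω
    have hω : X ω = fun i => θ i + σ / √(n : ℝ) * ε i ω := funext (hX ω)
    change standardizedStat μ σ n k θ (X ω) (est ω) ≤ x ↔
      standardizedStat μ σ n k θ (fun i => θ i + σ / √(n : ℝ) * ε i ω) (est ω) ≤ x
    rw [hω]
  rw [e1, ← map_measureReal_apply (h.measurable_est.prodMk hεm') hAm, hjoint,
    measureReal_def, Measure.prod_apply hAm, ← integral_toReal
      (measurable_measure_prodMk_left hAm).aemeasurable (ae_of_all _ fun _ => measure_lt_top _ _)]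
  rfl

/-! ### Reduction to the central limit theorem for a fixed estimator value -/

theorem standardizedStat_eq_quadLinSum {μ : Measure ℝ} {σ : ℝ} {n k : ℕ} (θ t e : ℕ → ℝ) (hn : 1 ≤ n) :
    standardizedStat μ σ n k θ (fun i => θ i + σ / √(n : ℝ) * e i) t =
      quadLinSum k ((σ / √(n : ℝ)) ^ 2 / √(scaleSq μ σ n k θ t))
        (fun i => 2 * (σ / √(n : ℝ)) * (θ i - t i) / √(scaleSq μ σ n k θ t)) e := by
  have hn' : (0 : ℝ) < n := by exact_mod_cast hn
  have ha : (σ / √(n : ℝ)) ^ 2 = σ ^ 2 / n := by rw [div_pow, Real.sq_sqrt hn'.le]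
  have hk : (k : ℝ) * σ ^ 2 / n = ∑ i ∈ Finset.range k, (σ / √(n : ℝ)) ^ 2 := by
    rw [ha]; simp; ring
  unfold standardizedStat quadLinSum sqDistEstimator sqDist quadLin
  rw [hk, ← Finset.sum_sub_distrib, ← Finset.sum_sub_distrib, Finset.sum_div]
  refine Finset.sum_congr rfl fun i _ => ?_
  ring

theorem integral_quadLin_div_sq (μ : Measure ℝ) (α β τ : ℝ) :
    ∫ e, quadLin (α / τ) (β / τ) e ^ 2 ∂μ = (∫ e, quadLin α β e ^ 2 ∂μ) / τ ^ 2 := by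
  rw [← integral_div]
  congr 1
  ext e
  unfold quadLin
  rw [← div_pow]
  congr 1
  ring

section Reduction

variable {μ : Measure ℝ} [IsProbabilityMeasure μ]

/-- Identifies τ² as the variance of the numerator given t, so the normalized sum has unit variance.
-/
theorem scaleSq_eq_sum {σ : ℝ} {n k : ℕ} (θ t : ℕ → ℝ) (hn : 1 ≤ n)
    (h4 : MemLp (fun e : ℝ => e) 4 μ) (h0 : ∫ e, e ∂μ = 0)
    (h1 : Var[fun e : ℝ => e; μ] = 1) :
    scaleSq μ σ n k θ t = ∑ i ∈ Finset.range k,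
      ∫ e, quadLin ((σ / √(n : ℝ)) ^ 2) (2 * (σ / √(n : ℝ)) * (θ i - t i)) e ^ 2 ∂μ := by
  have hn' : (0 : ℝ) < n := by exact_mod_cast hn
  have hs : √(n : ℝ) ^ 2 = n := Real.sq_sqrt hn'.le
  have hs0 : 0 < √(n : ℝ) := Real.sqrt_pos.2 hn'
  simp_rw [integral_quadLin_sq h4 h0 h1]
  unfold scaleSq
  rw [Finset.sum_add_distrib, Finset.sum_add_distrib, Finset.mul_sum, Finset.mul_sum]
  congr 1
  · congr 1
    · rw [Finset.sum_const, Finset.card_range, nsmul_eq_mul, div_pow, hs]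
      field_simp
    · refine Finset.sum_congr rfl fun i _ => ?_
      rw [mul_pow, mul_pow, div_pow, hs]
      field_simp
      ring
  · refine Finset.sum_congr rfl fun i _ => ?_
    rw [div_pow, hs]
    field_simp
    ring

/-- The normal approximation for a fixed value of the initial estimator for which no coordinate
dominates, with the constants of the central limit theorem. -/
theorem abs_real_standardizedStat_le_sub_cdf_le (h4 : MemLp (fun e : ℝ => e) 4 μ)
    (h0 : ∫ e, e ∂μ = 0) (h1 : Var[fun e : ℝ => e; μ] = 1) {κ r δ : ℝ} (hκ : 0 < κ)
    (hlow : ∀ α β, κ * (α ^ 2 + β ^ 2) ≤ ∫ e, quadLin α β e ^ 2 ∂μ) (hr : 0 < r)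
    (hclt : ∀ (k : ℕ) (α : ℝ) (β : ℕ → ℝ), |α| ≤ r → (∀ i < k, |β i| ≤ r) →
      ∑ i ∈ Finset.range k, ∫ e, quadLin α (β i) e ^ 2 ∂μ = 1 →
      ∀ x, |(Measure.infinitePi fun _ : ℕ => μ).real {e | quadLinSum k α β e ≤ x}
        - cdf (gaussianReal 0 1) x| ≤ δ)
    {σ η : ℝ} (hσ : 0 < σ) {n k : ℕ} (hn : 1 ≤ n) (hk : 1 ≤ k * (κ * r ^ 2))
    (hη : η ≤ κ * r ^ 2) {θ t : ℕ → ℝ} (hmax : ∀ i < k, (t i - θ i) ^ 2 ≤ η * sqDist k t θ)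
    (x : ℝ) :
    |(Measure.infinitePi fun _ : ℕ => μ).real
      {e | standardizedStat μ σ n k θ (fun i => θ i + σ / √(n : ℝ) * e i) t ≤ x}
        - cdf (gaussianReal 0 1) x| ≤ δ := by
  simp_rw [standardizedStat_eq_quadLinSum θ t _ hn]
  have hn' : (0 : ℝ) < n := by exact_mod_cast hn
  set a := σ / √(n : ℝ) with ha
  have ha0 : 0 < a := by positivity
  set S := scaleSq μ σ n k θ t with hS
  have hSsum := scaleSq_eq_sum (σ := σ) (k := k) θ t hn h4 h0 h1
  rw [← hS, ← ha] at hSsum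
  have hSlow : k * (κ * a ^ 4) + 4 * κ * a ^ 2 * sqDist k t θ ≤ S := by
    rw [hSsum]
    refine le_trans (le_of_eq ?_) (Finset.sum_le_sum fun i _ => hlow (a ^ 2) (2 * a * (θ i - t i)))
    rw [sqDist, Finset.mul_sum, ← nsmul_eq_mul]
    conv_lhs => rw [← Finset.card_range k, ← Finset.sum_const]
    rw [Finset.card_range, ← Finset.sum_add_distrib]
    exact Finset.sum_congr rfl fun i _ => by ring
  have hD0 : 0 ≤ sqDist k t θ := Finset.sum_nonneg fun _ _ => sq_nonneg _
  have hk0 : (0 : ℝ) < k := by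
    rcases Nat.eq_zero_or_pos k with rfl | h
    · norm_num at hk
    · exact_mod_cast h
  have hS0 : 0 < S := lt_of_lt_of_le (by positivity) hSlow
  have hτ : √S ^ 2 = S := Real.sq_sqrt hS0.le
  have hτ0 : 0 < √S := Real.sqrt_pos.2 hS0
  -- The term k κ a⁴ of `hSlow` controls the quadratic coefficient, as k is large; the term 4 κ a² ∑
  -- (t_i - θ_i)² controls the linear ones, as no coordinate dominates.
  refine hclt k _ _ ?_ (fun i hi => ?_) ?_ x
  · refine abs_le_of_sq_le_sq ?_ hr.le
    rw [div_pow, hτ, div_le_iff₀ hS0]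
    have h5 : (a ^ 2) ^ 2 * 1 ≤ (a ^ 2) ^ 2 * (k * (κ * r ^ 2)) :=
      mul_le_mul_of_nonneg_left hk (by positivity)
    have h6 : k * (κ * a ^ 4) ≤ S := by
      have : 0 ≤ 4 * κ * a ^ 2 * sqDist k t θ := by positivity
      linarith
    have h7 := mul_le_mul_of_nonneg_left h6 (sq_nonneg r)
    nlinarith
  · refine abs_le_of_sq_le_sq ?_ hr.le
    rw [div_pow, hτ, div_le_iff₀ hS0]
    have h5 : (t i - θ i) ^ 2 ≤ κ * r ^ 2 * sqDist k t θ :=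
      (hmax i hi).trans (mul_le_mul_of_nonneg_right hη hD0)
    have h6 : 4 * κ * a ^ 2 * sqDist k t θ ≤ S := by
      have : 0 ≤ (k : ℝ) * (κ * a ^ 4) := by positivity
      linarith
    have h7 := mul_le_mul_of_nonneg_left h6 (sq_nonneg r)
    have h8 := mul_le_mul_of_nonneg_left h5 (by positivity : 0 ≤ 4 * a ^ 2)
    nlinarith
  · simp_rw [integral_quadLin_div_sq, hτ]
    rw [← Finset.sum_div, ← hSsum, div_self hS0.ne']

end Reduction

/-! ### Uniformity over the parameter set -/

/-- Quantitative normal approximation in the sequence model: the error is at most `δ` plus the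
probability that one coordinate of the initial estimator dominates. -/
theorem IsSequenceModel.abs_real_standardizedStat_le_sub_cdf_le {Ω : Type*} [MeasurableSpace Ω]
    {P : Measure Ω} {μ : Measure ℝ} [IsProbabilityMeasure μ] {σ : ℝ} {n : ℕ} {θ : ℕ → ℝ}
    {X est : Ω → ℕ → ℝ} (h : IsSequenceModel P μ σ n θ X est) (hσ : 0 < σ) (hn : 1 ≤ n)
    {k : ℕ} {η δ x : ℝ} (hδ : 0 ≤ δ)
    (hgood : ∀ t : ℕ → ℝ, (∀ i < k, (t i - θ i) ^ 2 ≤ η * sqDist k t θ) →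
      |(Measure.infinitePi fun _ : ℕ => μ).real
        {e | standardizedStat μ σ n k θ (fun i => θ i + σ / √(n : ℝ) * e i) t ≤ x}
          - cdf (gaussianReal 0 1) x| ≤ δ) :
    |P.real {ω | standardizedStat μ σ n k θ (X ω) (est ω) ≤ x} - cdf (gaussianReal 0 1) x| ≤
      P.real {ω | (⨆ i : Fin k, |est ω i - θ i| ^ 2) > η * sqDist k (est ω) θ} + δ := by
  have := h.isProbabilityMeasure
  have hPm : IsProbabilityMeasure (P.map est) :=
    Measure.isProbabilityMeasure_map h.measurable_est.aemeasurable
  set B : Set (ℕ → ℝ) := {t | (⨆ i : Fin k, |t i - θ i| ^ 2) > η * sqDist k t θ} with hB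
  have hBm : MeasurableSet B := by
    refine measurableSet_lt ((measurable_sqDist_left k θ).const_mul η) ?_
    exact Measurable.iSup fun i => by fun_prop
  have e : P.real {ω | (⨆ i : Fin k, |est ω i - θ i| ^ 2) > η * sqDist k (est ω) θ} =
      (P.map est).real B := (map_measureReal_apply h.measurable_est hBm).symm
  rw [e, h.real_standardizedStat_le_eq_integral hσ hn]
  refine abs_integral_sub_le_real_add ?_ (fun _ => measureReal_nonneg)
    (fun _ => measureReal_le_one) (cdf_nonneg _ _) (cdf_le_one _ _) hδ hBm fun t ht => ?_
  · have hm : Measurable fun p : (ℕ → ℝ) × (ℕ → ℝ) =>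
        (p.1, fun i => θ i + σ / √(n : ℝ) * p.2 i) := by fun_prop
    exact (measurable_measure_prodMk_left
      (((measurable_standardizedStat μ σ n k θ).comp hm) measurableSet_Iic)).ennreal_toReal
  · refine hgood t fun i hi => ?_
    have h1 : (⨆ i : Fin k, |t i - θ i| ^ 2) ≤ η * sqDist k t θ := not_lt.1 ht
    rw [← sq_abs]
    exact (le_ciSup (f := fun i : Fin k => |t i - θ i| ^ 2)
      (Set.finite_range _).bddAbove ⟨i, hi⟩).trans h1

theorem theorem3p4
    (μ : Measure ℝ) [IsProbabilityMeasure μ]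
    (hμ_four : MemLp (fun e : ℝ => e) 4 μ)
    (hμ_mean : ∫ e, e ∂μ = 0)
    (hμ_var : Var[fun e : ℝ => e; μ] = 1)
    (hμ_corr : cov[fun e : ℝ => e ^ 2, fun e : ℝ => e; μ] ^ 2 < Var[fun e : ℝ => e ^ 2; μ])
    (σ : ℝ) (hσ : 0 < σ)
    (Θ : ℕ → Set (lp (fun _ : ℕ => ℝ) 2))
    {Ω : ℕ → Type*} [∀ n, MeasurableSpace (Ω n)]
    (P : (n : ℕ) → lp (fun _ : ℕ => ℝ) 2 → Measure (Ω n))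
    (X est : (n : ℕ) → Ω n → ℕ → ℝ)
    (hmodel : ∀ n, 1 ≤ n → ∀ θ ∈ Θ n, IsSequenceModel (P n θ) μ σ n θ (X n) (est n))
    (k : ℕ → ℕ) (hk : Tendsto k atTop atTop)
    (η : ℕ → ℝ) (hη : Tendsto η atTop (𝓝 0))
    (hmax : Tendsto
      (fun n => ⨆ θ : Θ n, (P n θ).real
        {ω | (⨆ i : Fin (k n), |est n ω i - θ.1 i| ^ 2) > η n * sqDist (k n) (est n ω) θ.1})
      atTop (𝓝 0)) :
    Tendsto
      (fun n => ⨆ θ : Θ n, ⨆ x : ℝ,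
        |(P n θ).real {ω | standardizedStat μ σ n (k n) θ.1 (X n ω) (est n ω) ≤ x}
          - cdf (gaussianReal 0 1) x|)
      atTop (𝓝 0) := by

  set v := Var[fun e : ℝ => e ^ 2; μ] with hv
  set c := cov[fun e : ℝ => e ^ 2, fun e : ℝ => e; μ] with hc
  have hκ : 0 < (v - c ^ 2) / (1 + v) :=
    div_pos (by linarith) (by nlinarith [sq_nonneg c])
  set κ := (v - c ^ 2) / (1 + v)
  have hlow : ∀ α β, κ * (α ^ 2 + β ^ 2) ≤ ∫ e, quadLin α β e ^ 2 ∂μ := fun α β => by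
    rw [integral_quadLin_sq hμ_four hμ_mean hμ_var]
    exact mul_sq_add_sq_le_of_sq_lt hμ_corr α β
  rw [Metric.tendsto_nhds] at hmax ⊢
  intro δ hδ
  -- Budget: δ/4 for the normal approximation and δ/2 for dominating coordinates. The radius r
  -- depends on μ and δ alone, so the same n serves all θ.
  obtain ⟨r, hr, hclt⟩ := exists_forall_abs_real_quadLinSum_sub_cdf_le hμ_four hμ_mean hμ_var hκ
    hlow (half_pos (half_pos hδ))
  have hκr : 0 < κ * r ^ 2 := by positivity
  have hk' : ∀ᶠ n in atTop, 1 ≤ k n * (κ * r ^ 2) :=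
    ((tendsto_natCast_atTop_atTop.comp hk).atTop_mul_const hκr).eventually_ge_atTop 1
  filter_upwards [hmax (δ / 2) (half_pos hδ), hk', hη.eventually (ge_mem_nhds hκr),
    eventually_ge_atTop 1] with n hn1 hn2 hn3 hn4
  rw [Real.dist_eq, sub_zero] at hn1 ⊢
  -- A real supremum dominates its members only if the family is bounded above.
  have hbdd : BddAbove (Set.range fun θ : Θ n => (P n θ).real
      {ω | (⨆ i : Fin (k n), |est n ω i - θ.1 i| ^ 2) > η n * sqDist (k n) (est n ω) θ.1}) := by
    refine ⟨1, ?_⟩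
    rintro _ ⟨θ, rfl⟩
    have := (hmodel n hn4 θ.1 θ.2).isProbabilityMeasure
    exact measureReal_le_one
  rw [abs_of_nonneg (Real.iSup_nonneg fun _ => Real.iSup_nonneg fun _ => abs_nonneg _)]
  have hb0 := Real.iSup_nonneg fun θ : Θ n => (measureReal_nonneg (μ := P n θ)
    (s := {ω | (⨆ i : Fin (k n), |est n ω i - θ.1 i| ^ 2) > η n * sqDist (k n) (est n ω) θ.1}))
  refine lt_of_le_of_lt (b := (⨆ θ : Θ n, (P n θ).real
      {ω | (⨆ i : Fin (k n), |est n ω i - θ.1 i| ^ 2) > η n * sqDist (k n) (est n ω) θ.1})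
      + δ / 2 / 2) ?_ (by linarith [(abs_lt.1 hn1).2])
  -- Nonnegativity of the bound covers an empty `Θ n`, where the supremum is 0 by convention.
  refine Real.iSup_le (fun θ => Real.iSup_le (fun x => ?_) (by positivity)) (by positivity)
  refine ((hmodel n hn4 θ.1 θ.2).abs_real_standardizedStat_le_sub_cdf_le hσ hn4 (by positivity)
    fun t ht => abs_real_standardizedStat_le_sub_cdf_le hμ_four hμ_mean hμ_var hκ hlow hr hclt hσ
      hn4 hn2 hn3 ht x).trans ?_
  exact add_le_add_left (le_ciSup hbdd θ) _
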